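/- Let $\Psi\in\mathbb{C}^{m\times n}$ have columns (atoms) $\psi_1,\dots,\psi_n$ with $\|\psi_j\|_2=1$, and let $\mu=\mu(\Psi)=\max_{i\ne j}|\psi_i^H\psi_j|$ (with $\mu=0$ if $n=1$). Let $x\in\mathbb{C}^n$ be nonzero with support $S=\{i: x_i\neq 0\}$, $|S|\le k$, and let $y=\Psi x+\mathbf{n}$, where $\mathbf{n}\sim CN(0,\sigma^2 I_m)$, $\sigma\ge 0$; that is, the $2m$ real and imaginary parts of the entries of $\mathbf{n}$ are independent real Gaussians with mean $0$ and variance $\sigma^2/2$. Put $$b=\sigma\sqrt{m+\sqrt{2m\ln(2m)}} .$$ Orthogonal matching pursuit (OMP) with stopping rule $\|r_i\|_2\le b$ starts from $c_0=\emptyset$ and $r_0=y$. At step $i=1,2,\dots$ it selects an index $t_i$ maximizing $|\psi_t^H r_{i-1}|$ over $t\in\{1,\dots,n\}$ (ties broken arbitrarily), sets $c_i=c_{i-1}\cup\{t_i\}$ and $r_i=(I-P_i)y$, where $P_i$ is the orthogonal projection onto the linear span of $\{\psi_t: t\in c_i\}$, and stops at the first $i\ge 1$ with $\|r_i\|_2\le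 b$; the selected set is then $c_i$. Suppose that $\mu<\frac{1}{2k-1}$ and that every nonzero coefficient satisfies $$|x_i|\ \ge\ \frac{2\sigma\sqrt{m+\sqrt{2m\ln(2m)}}}{1-(2k-1)\mu}.$$ Then, with probability at least $1-\frac{1}{2\sqrt{\pi\ln(2m)}}$, OMP with stopping rule $\|r_i\|_2\le b$ stops and the set it has selected is exactly $S$, however ties are broken. -/

import Mathlib

open MeasureTheory ProbabilityTheory
open scoped NNReal InnerProductSpace

noncomputable section

/-- The circularly symmetric complex Gaussian law `CN(0, v)` on `ℂ`: the real and the imaginary part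
are independent real Gaussians of mean `0` and variance `v / 2` each. -/
def complexGaussian (v : ℝ≥0) : Measure ℂ :=
  ((gaussianReal 0 (v / 2)).prod (gaussianReal 0 (v / 2))).map (fun p : ℝ × ℝ => (⟨p.1, p.2⟩ : ℂ))

/-- The law `CN(0, v I_m)` on `ℂ^m`: the entries are i.i.d. with law `CN(0, v)`. -/
def complexGaussianVector (m : ℕ) (v : ℝ≥0) : Measure (EuclideanSpace ℂ (Fin m)) :=
  (Measure.pi (fun _ : Fin m => complexGaussian v)).map (WithLp.toLp 2)

/-- The `j`-th atom (column) of the dictionary `Ψ`, as a vector of the Hermitian space `ℂ^m`. -/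
def atom {m n : ℕ} (Ψ : Matrix (Fin m) (Fin n) ℂ) (j : Fin n) : EuclideanSpace ℂ (Fin m) :=
  WithLp.toLp 2 (fun i => Ψ i j)

/-- The mutual incoherence `max_{i ≠ j} |ψ_i^H ψ_j|` of a dictionary with normalized atoms
(it is `0` when there are no two distinct atoms). -/
def mutualCoherence {m n : ℕ} (Ψ : Matrix (Fin m) (Fin n) ℂ) : ℝ :=
  ⨆ p : {p : Fin n × Fin n // p.1 ≠ p.2}, ‖⟪atom Ψ p.1.1, atom Ψ p.1.2⟫_ℂ‖

/-- The support of a vector. -/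
def vecSupport {n : ℕ} (x : Fin n → ℂ) : Finset (Fin n) :=
  {i : Fin n | x i ≠ 0}

/-- The residual `(I - P) y`, where `P` is the orthogonal projection onto the linear span of the
atoms with indices in `c`. -/
def ompResidual {m n : ℕ} (Ψ : Matrix (Fin m) (Fin n) ℂ) (y : EuclideanSpace ℂ (Fin m))
    (c : Finset (Fin n)) : EuclideanSpace ℂ (Fin m) :=
  y - (Submodule.span ℂ (atom Ψ '' (c : Set (Fin n)))).starProjection y

/-- The set of indices selected in the first `i` steps, when step `i + 1` selects `t i`. -/
def selectedSet {n : ℕ} (t : ℕ → Fin n) (i : ℕ) : Finset (Fin n) :=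
  (Finset.range i).image t

/-- `t` is a sequence of selections of orthogonal matching pursuit on the input `y`: each step
selects an index that maximizes `|ψ_j^H r|`, with `r` the current residual. Ties may be broken in
any way. The sequence is the one generated when the stopping rule is ignored. -/
def IsOMPSequence {m n : ℕ} (Ψ : Matrix (Fin m) (Fin n) ℂ) (y : EuclideanSpace ℂ (Fin m))
    (t : ℕ → Fin n) : Prop :=
  ∀ (i : ℕ) (j : Fin n),
    ‖⟪atom Ψ j, ompResidual Ψ y (selectedSet t i)⟫_ℂ‖ ≤
      ‖⟪atom Ψ (t i), ompResidual Ψ y (selectedSet t i)⟫_ℂ‖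

/-- `N` is the step after which orthogonal matching pursuit stops: the first `N ≥ 1` such that the
residual after `N` selections has norm at most `ε` (the test is made after each selection). -/
def IsOMPStop {m n : ℕ} (Ψ : Matrix (Fin m) (Fin n) ℂ) (y : EuclideanSpace ℂ (Fin m)) (ε : ℝ)
    (t : ℕ → Fin n) (N : ℕ) : Prop :=
  IsLeast {i : ℕ | 1 ≤ i ∧ ‖ompResidual Ψ y (selectedSet t i)‖ ≤ ε} N

/-- Orthogonal matching pursuit on the input `y`, with stopping rule `‖r_i‖ ≤ ε`, selects exactly
the index set `S`: however ties are broken, it stops, and the set selected by then is `S`. -/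
def OMPSelects {m n : ℕ} (Ψ : Matrix (Fin m) (Fin n) ℂ) (y : EuclideanSpace ℂ (Fin m)) (ε : ℝ)
    (S : Finset (Fin n)) : Prop :=
  ∀ t : ℕ → Fin n, IsOMPSequence Ψ y t → ∃ N : ℕ, IsOMPStop Ψ y ε t N ∧ selectedSet t N = S

/-- As soon as there is an atom, a selection sequence exists, so `OMPSelects` is not vacuous. -/
theorem exists_isOMPSequence {m n : ℕ} [NeZero n] (Ψ : Matrix (Fin m) (Fin n) ℂ)
    (y : EuclideanSpace ℂ (Fin m)) : ∃ t : ℕ → Fin n, IsOMPSequence Ψ y t := by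
  have h : ∀ c : Finset (Fin n), ∃ j₀ : Fin n, ∀ j,
      ‖⟪atom Ψ j, ompResidual Ψ y c⟫_ℂ‖ ≤ ‖⟪atom Ψ j₀, ompResidual Ψ y c⟫_ℂ‖ := fun c =>
    Finite.exists_max fun j => ‖⟪atom Ψ j, ompResidual Ψ y c⟫_ℂ‖
  choose g hg using h
  let C : ℕ → Finset (Fin n) := fun i => Nat.rec ∅ (fun _ c => insert (g c) c) i
  have hC : ∀ i, selectedSet (fun i => g (C i)) i = C i := by
    intro i
    induction i with
    | zero => rfl
    | succ i ih =>
      have : C (i + 1) = insert (g (C i)) (C i) := rfl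
      rw [this, ← ih, selectedSet, Finset.range_add_one, Finset.image_insert, ← selectedSet, ih]
  refine ⟨fun i => g (C i), fun i j => ?_⟩
  rw [hC]
  exact hg _ j

end

/-! Let `e` be the noise, `S` the support, `b` the tolerance, and suppose `‖e‖ < b` (or `e = 0`).
While the selected set `c` is a proper subset of `S`, the residual is `∑ w_j ψ_j` plus the projected
noise, with `w = x` off `c` and `w = 0` off `S`. At an index where `|w_j| = W` is maximal the signal
correlation is at least `(1 - (k-1)μ) W`; off `S` it is at most `kμW`; noise shifts each by at most
`‖e‖`. That index is not in `c`, so `w_j = x_j` there and the coefficient bound separates the two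
(`exists_lt_norm_inner_atom_ompResidual`). Each step thus picks a new index of `S`, and the residual
stays above `b` until `S` is exhausted, when only projected noise remains (`ompSelects_of_norm_le`).

For the probability, `‖e‖²/σ²` (when `σ > 0`) has an Erlang law, with tail at most `e^{-a} ∑_{j<m}
a^j/j!` (`pi_complexGaussian_one_tail_le`). At `a = m + √(2m ln(2m))`, comparing the sum with
`a^m/(m-1)!` and applying Stirling's bound give the stated constant (`exp_neg_mul_sum_le`). -/

/-! ### Residuals, coherence and correlations -/

theorem toLp_mulVec_eq_sum_atom {m n : ℕ} (Ψ : Matrix (Fin m) (Fin n) ℂ) (x : Fin n → ℂ) :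
    (WithLp.toLp 2 (Ψ.mulVec x) : EuclideanSpace ℂ (Fin m)) = ∑ j, x j • atom Ψ j := by
  ext i
  simp [atom, Matrix.mulVec, dotProduct, mul_comm]

theorem mutualCoherence_nonneg {m n : ℕ} (Ψ : Matrix (Fin m) (Fin n) ℂ) :
    0 ≤ mutualCoherence Ψ :=
  Real.iSup_nonneg fun _ => norm_nonneg _

theorem norm_inner_atom_le_mutualCoherence {m n : ℕ} (Ψ : Matrix (Fin m) (Fin n) ℂ)
    {i j : Fin n} (h : i ≠ j) : ‖⟪atom Ψ i, atom Ψ j⟫_ℂ‖ ≤ mutualCoherence Ψ :=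
  le_ciSup (f := fun p : {p : Fin n × Fin n // p.1 ≠ p.2} =>
    ‖⟪atom Ψ p.1.1, atom Ψ p.1.2⟫_ℂ‖) (Set.finite_range _).bddAbove ⟨(i, j), h⟩

theorem ompResidual_add {m n : ℕ} (Ψ : Matrix (Fin m) (Fin n) ℂ)
    (y z : EuclideanSpace ℂ (Fin m)) (c : Finset (Fin n)) :
    ompResidual Ψ (y + z) c = ompResidual Ψ y c + ompResidual Ψ z c := by
  simp only [ompResidual, map_add]
  abel

theorem norm_ompResidual_le {m n : ℕ} (Ψ : Matrix (Fin m) (Fin n) ℂ)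
    (y : EuclideanSpace ℂ (Fin m)) (c : Finset (Fin n)) : ‖ompResidual Ψ y c‖ ≤ ‖y‖ := by
  have h : ompResidual Ψ y c =
      (Submodule.span ℂ (atom Ψ '' (c : Set (Fin n))))ᗮ.starProjection y := by
    rw [Submodule.starProjection_orthogonal_val]
    rfl
  rw [h]
  exact Submodule.norm_starProjection_apply_le _ y

theorem inner_atom_ompResidual_eq_zero {m n : ℕ} (Ψ : Matrix (Fin m) (Fin n) ℂ)
    (y : EuclideanSpace ℂ (Fin m)) {c : Finset (Fin n)} {j : Fin n} (hj : j ∈ c) :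
    ⟪atom Ψ j, ompResidual Ψ y c⟫_ℂ = 0 :=
  (Submodule.mem_orthogonal _ _).1 (Submodule.sub_starProjection_mem_orthogonal y) _
    (Submodule.subset_span ⟨j, hj, rfl⟩)

theorem ompResidual_eq_zero_of_mem_span {m n : ℕ} (Ψ : Matrix (Fin m) (Fin n) ℂ)
    {y : EuclideanSpace ℂ (Fin m)} {c : Finset (Fin n)}
    (hy : y ∈ Submodule.span ℂ (atom Ψ '' (c : Set (Fin n)))) : ompResidual Ψ y c = 0 := by
  rw [ompResidual, Submodule.starProjection_eq_self_iff.2 hy, sub_self]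

/-- The residual of a combination of atoms is a combination of atoms, with the same coefficients
off the selected set. -/
theorem exists_ompResidual_sum_eq {m n : ℕ} (Ψ : Matrix (Fin m) (Fin n) ℂ) (x : Fin n → ℂ)
    (c : Finset (Fin n)) :
    ∃ w : Fin n → ℂ, (∀ j ∉ c, w j = x j) ∧
      ompResidual Ψ (∑ j, x j • atom Ψ j) c = ∑ j, w j • atom Ψ j := by
  have hmem := Submodule.starProjection_apply_mem
    (Submodule.span ℂ (atom Ψ '' (c : Set (Fin n)))) (∑ j, x j • atom Ψ j)
  obtain ⟨a, ha⟩ := (Submodule.mem_span_image_finset_iff_exists_fun ℂ).1 hmem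
  let a' : Fin n → ℂ := fun j => if h : j ∈ c then a ⟨j, h⟩ else 0
  have ha' : ∑ i, a i • atom Ψ ↑i = ∑ j, a' j • atom Ψ j := by
    rw [← Finset.sum_subset (Finset.subset_univ c) fun j _ hj => by simp [a', hj],
      ← Finset.sum_coe_sort c]
    exact Finset.sum_congr rfl fun j _ => by simp [a']
  refine ⟨fun j => x j - a' j, fun j hj => by simp [a', hj], ?_⟩
  rw [ompResidual, ← ha, ha']
  simp only [sub_smul, Finset.sum_sub_distrib]

/-- The diagonal term is `w t` since atoms are unit vectors; every other term costs at most `μW`.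
Using `S.erase t` covers both `t ∈ S` (`|S| - 1` terms) and `t ∉ S` (`|S|` terms). -/
theorem norm_inner_atom_sum_sub_le {m n : ℕ} (Ψ : Matrix (Fin m) (Fin n) ℂ)
    (hΨ : ∀ j, ‖atom Ψ j‖ = 1) (w : Fin n → ℂ) {S : Finset (Fin n)} (hw : ∀ j ∉ S, w j = 0)
    {W : ℝ} (hW : ∀ j, ‖w j‖ ≤ W) (t : Fin n) :
    ‖⟪atom Ψ t, ∑ j, w j • atom Ψ j⟫_ℂ - w t‖ ≤
      ((S.erase t).card : ℝ) * (mutualCoherence Ψ * W) := by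
  have htt : ⟪atom Ψ t, atom Ψ t⟫_ℂ = 1 := by simp [inner_self_eq_norm_sq_to_K, hΨ]
  have h : ⟪atom Ψ t, ∑ j, w j • atom Ψ j⟫_ℂ - w t =
      ∑ j ∈ S.erase t, w j * ⟪atom Ψ t, atom Ψ j⟫_ℂ := by
    simp only [inner_sum, inner_smul_right]
    rw [← Finset.add_sum_erase _ _ (Finset.mem_univ t), htt, mul_one, add_sub_cancel_left]
    refine (Finset.sum_subset (Finset.erase_subset_erase t (Finset.subset_univ S)) ?_).symm
    intro j hj hjS
    rw [hw j fun h => hjS (Finset.mem_erase.2 ⟨(Finset.mem_erase.1 hj).1, h⟩), zero_mul]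
  rw [h, ← nsmul_eq_mul]
  refine (norm_sum_le _ _).trans (Finset.sum_le_card_nsmul _ _ _ fun j hj => ?_)
  rw [norm_mul, mul_comm]
  exact mul_le_mul (norm_inner_atom_le_mutualCoherence Ψ (Finset.mem_erase.1 hj).1.symm) (hW j)
    (norm_nonneg _) (mutualCoherence_nonneg Ψ)

/-! ### Exact recovery for a fixed error -/

/-- As long as the selected set misses a part of the support, the largest correlation with the
residual exceeds both the tolerance and every correlation with an atom off the support. -/
theorem exists_lt_norm_inner_atom_ompResidual {m n k : ℕ} (Ψ : Matrix (Fin m) (Fin n) ℂ)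
    (hΨ : ∀ j, ‖atom Ψ j‖ = 1) (x : Fin n → ℂ) (hk : (vecSupport x).card ≤ k)
    (e : EuclideanSpace ℂ (Fin m)) {b : ℝ} (heb : ‖e‖ ≤ b)
    (hmin : ∀ i, x i ≠ 0 →
      ‖e‖ + b < (1 - (2 * (k : ℝ) - 1) * mutualCoherence Ψ) * ‖x i‖)
    (hμ : 0 < 1 - (2 * (k : ℝ) - 1) * mutualCoherence Ψ)
    {c : Finset (Fin n)} (hc : c ⊂ vecSupport x) :
    ∃ j, b < ‖⟪atom Ψ j, ompResidual Ψ (∑ j, x j • atom Ψ j + e) c⟫_ℂ‖ ∧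
      ∀ t ∉ vecSupport x, ‖⟪atom Ψ t, ompResidual Ψ (∑ j, x j • atom Ψ j + e) c⟫_ℂ‖ <
        ‖⟪atom Ψ j, ompResidual Ψ (∑ j, x j • atom Ψ j + e) c⟫_ℂ‖ := by
  obtain ⟨i₀, hi₀S, hi₀c⟩ := Finset.exists_of_ssubset hc
  have : Nonempty (Fin n) := ⟨i₀⟩
  obtain ⟨w, hwc, hw⟩ := exists_ompResidual_sum_eq Ψ x c
  have hwS : ∀ j ∉ vecSupport x, w j = 0 := fun j hj => by
    rw [hwc j fun h => hj (hc.1 h)]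
    simpa [vecSupport] using hj
  obtain ⟨j, hj⟩ := Finite.exists_max fun j => ‖w j‖
  have hx₀ : x i₀ ≠ 0 := by simpa [vecSupport] using hi₀S
  have hWpos : 0 < ‖w j‖ :=
    lt_of_lt_of_le (by rw [hwc i₀ hi₀c]; exact norm_pos_iff.2 hx₀) (hj i₀)
  have hjS : j ∈ vecSupport x := by
    by_contra h
    rw [hwS j h, norm_zero] at hWpos
    exact hWpos.false
  have hμ0 := mutualCoherence_nonneg Ψ
  have hkμ : (1 : ℝ) ≤ k := by
    exact_mod_cast (Finset.card_pos.2 ⟨_, hjS⟩).trans_le hk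
  have hμW : 0 ≤ mutualCoherence Ψ * ‖w j‖ := mul_nonneg hμ0 hWpos.le
  have hsig_j : ‖⟪atom Ψ j, ∑ i, w i • atom Ψ i⟫_ℂ‖ ≥
      ‖w j‖ - (k - 1) * (mutualCoherence Ψ * ‖w j‖) := by
    have h1 := norm_inner_atom_sum_sub_le Ψ hΨ w hwS hj j
    have h2 : (((vecSupport x).erase j).card : ℝ) ≤ k - 1 := by
      rw [Finset.card_erase_of_mem hjS, Nat.cast_sub (Finset.card_pos.2 ⟨_, hjS⟩)]
      push_cast
      have : ((vecSupport x).card : ℝ) ≤ k := by exact_mod_cast hk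
      linarith
    have h3 := mul_le_mul_of_nonneg_right h2 hμW
    have h4 := norm_sub_norm_le (w j) ⟪atom Ψ j, ∑ i, w i • atom Ψ i⟫_ℂ
    rw [norm_sub_rev] at h4
    linarith
  have hsig_t : ∀ t ∉ vecSupport x, ‖⟪atom Ψ t, ∑ i, w i • atom Ψ i⟫_ℂ‖ ≤
      k * (mutualCoherence Ψ * ‖w j‖) := fun t ht => by
    have h1 := norm_inner_atom_sum_sub_le Ψ hΨ w hwS hj t
    rw [hwS t ht, sub_zero, Finset.erase_eq_of_notMem ht] at h1
    exact h1.trans (mul_le_mul_of_nonneg_right (by exact_mod_cast hk) hμW)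
  -- The noiseless residual is orthogonal to the selected atoms, whereas its correlation with atom
  -- `j` is positive.
  have hjc : j ∉ c := fun h => by
    have h0 := inner_atom_ompResidual_eq_zero Ψ (∑ j, x j • atom Ψ j) h
    rw [hw] at h0
    rw [h0, norm_zero] at hsig_j
    nlinarith [mul_pos hμ hWpos, mul_nonneg (by linarith : (0 : ℝ) ≤ k) hμW]
  have hxj := hmin j (by simpa [vecSupport] using hjS)
  rw [← hwc j hjc] at hxj
  have hnoise : ∀ t, ‖⟪atom Ψ t, ompResidual Ψ e c⟫_ℂ‖ ≤ ‖e‖ := fun t => by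
    refine (norm_inner_le_norm _ _).trans ?_
    rw [hΨ, one_mul]
    exact norm_ompResidual_le Ψ e c
  have hr : ∀ t, ⟪atom Ψ t, ompResidual Ψ (∑ j, x j • atom Ψ j + e) c⟫_ℂ =
      ⟪atom Ψ t, ∑ i, w i • atom Ψ i⟫_ℂ + ⟪atom Ψ t, ompResidual Ψ e c⟫_ℂ := fun t => by
    rw [ompResidual_add, hw, inner_add_right]
  -- This is `(1 - (k-1)μ) W - ‖e‖ > kμW + b`, a rearrangement of `hxj`.
  have hbig : k * (mutualCoherence Ψ * ‖w j‖) + b <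
      ‖⟪atom Ψ j, ompResidual Ψ (∑ j, x j • atom Ψ j + e) c⟫_ℂ‖ := by
    have h1 := norm_sub_le_norm_add ⟪atom Ψ j, ∑ i, w i • atom Ψ i⟫_ℂ
      ⟪atom Ψ j, ompResidual Ψ e c⟫_ℂ
    rw [hr]
    nlinarith [hnoise j]
  refine ⟨j, ?_, fun t ht => ?_⟩
  · nlinarith [mul_nonneg (by linarith : (0 : ℝ) ≤ k) hμW]
  · refine lt_of_le_of_lt ?_ hbig
    rw [hr]
    exact (norm_add_le _ _).trans (add_le_add (hsig_t t ht) ((hnoise t).trans heb))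

theorem selectedSet_succ {n : ℕ} (t : ℕ → Fin n) (i : ℕ) :
    selectedSet t (i + 1) = insert (t i) (selectedSet t i) := by
  rw [selectedSet, Finset.range_add_one, Finset.image_insert, ← selectedSet]

/-- Deterministic exact recovery: OMP selects the support as soon as the error is small compared
with the tolerance and the nonzero coefficients. -/
theorem ompSelects_of_norm_le {m n k : ℕ} (Ψ : Matrix (Fin m) (Fin n) ℂ)
    (hΨ : ∀ j, ‖atom Ψ j‖ = 1) (x : Fin n → ℂ) (hx : x ≠ 0) (hk : (vecSupport x).card ≤ k)
    (e : EuclideanSpace ℂ (Fin m)) {b : ℝ} (heb : ‖e‖ ≤ b)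
    (hmin : ∀ i, x i ≠ 0 →
      ‖e‖ + b < (1 - (2 * (k : ℝ) - 1) * mutualCoherence Ψ) * ‖x i‖)
    (hμ : 0 < 1 - (2 * (k : ℝ) - 1) * mutualCoherence Ψ) :
    OMPSelects Ψ (WithLp.toLp 2 (Ψ.mulVec x) + e) b (vecSupport x) := by
  rw [toLp_mulVec_eq_sum_atom]
  intro t ht
  have key : ∀ c, c ⊂ vecSupport x → _ := fun c hc =>
    exists_lt_norm_inner_atom_ompResidual Ψ hΨ x hk e heb hmin hμ hc
  have hb : 0 ≤ b := (norm_nonneg e).trans heb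
  have hsel : ∀ i ≤ (vecSupport x).card,
      selectedSet t i ⊆ vecSupport x ∧ (selectedSet t i).card = i := by
    intro i
    induction i with
    | zero => intro _; simp [selectedSet]
    | succ i ih =>
      intro hi
      obtain ⟨hsub, hcard⟩ := ih (Nat.le_of_succ_le hi)
      have hss : selectedSet t i ⊂ vecSupport x :=
        hsub.ssubset_of_ne fun h => by rw [h] at hcard; omega
      obtain ⟨j, hj, hlt⟩ := key _ hss
      have hti := ht i j
      have htS : t i ∈ vecSupport x := by
        by_contra h
        exact (hlt _ h).not_ge hti
      -- Selected atoms have zero correlation with the residual, while the maximum exceeds `b ≥ 0`;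
      -- no linear independence is needed.
      have htc : t i ∉ selectedSet t i := fun h => by
        rw [inner_atom_ompResidual_eq_zero Ψ _ h, norm_zero] at hti
        linarith
      rw [selectedSet_succ]
      exact ⟨Finset.insert_subset htS hsub, by rw [Finset.card_insert_of_notMem htc, hcard]⟩
  have hfull : selectedSet t (vecSupport x).card = vecSupport x :=
    Finset.eq_of_subset_of_card_le (hsel _ le_rfl).1 (hsel _ le_rfl).2.ge
  refine ⟨(vecSupport x).card, ⟨⟨?_, ?_⟩, ?_⟩, hfull⟩
  · obtain ⟨i, hi⟩ := Function.ne_iff.1 hx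
    exact Finset.card_pos.2 ⟨i, by simpa [vecSupport] using hi⟩
  · rw [hfull, ompResidual_add, ompResidual_eq_zero_of_mem_span, zero_add]
    · exact (norm_ompResidual_le Ψ e _).trans heb
    · refine Submodule.sum_mem _ fun j _ => ?_
      by_cases hj : x j = 0
      · simp [hj]
      · exact Submodule.smul_mem _ _ (Submodule.subset_span ⟨j, by simpa [vecSupport] using hj, rfl⟩)
  -- No earlier stop: a unit atom with correlation above `b` forces the residual norm above `b`.
  · rintro i ⟨-, hi⟩
    by_contra! hlt
    obtain ⟨hsub, hcard⟩ := hsel i hlt.le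
    obtain ⟨j, hj, -⟩ := key _ (hsub.ssubset_of_ne fun h => by rw [h] at hcard; omega)
    have := norm_inner_le_norm (𝕜 := ℂ) (atom Ψ j)
      (ompResidual Ψ (∑ j, x j • atom Ψ j + e) (selectedSet t i))
    rw [hΨ, one_mul] at this
    linarith

/-! ### Truncated exponential sums -/

open Finset in
-- Since `a · a^j/j! = (j+1) a^{j+1}/(j+1)!`, the left side equals the right side minus `∑_{j≤m}
-- (m+1-j) a^j/j! ≥ 0`.
theorem sub_mul_sum_pow_div_factorial_le (m : ℕ) {a : ℝ} (ha : 0 ≤ a) :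
    (a - (m + 1)) * ∑ j ∈ range (m + 1), a ^ j / (j.factorial : ℝ) ≤
      a ^ (m + 1) / (m.factorial : ℝ) := by
  induction m with
  | zero => simp
  | succ m ih =>
    rw [sum_range_succ]
    have hT : a ^ m / (m.factorial : ℝ) ≤ ∑ j ∈ range (m + 1), a ^ j / (j.factorial : ℝ) :=
      single_le_sum (f := fun j => a ^ j / (j.factorial : ℝ)) (fun j _ => by positivity)
        (mem_range.2 m.lt_succ_self)
    have hm : (0 : ℝ) < m.factorial := by positivity
    have h1 : a ^ (m + 1) / (m.factorial : ℝ) =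
        (m + 1) * (a ^ (m + 1) / ((m + 1).factorial : ℝ)) := by
      rw [Nat.factorial_succ]
      push_cast
      field_simp
    have h2 : a ^ (m + 1 + 1) / ((m + 1).factorial : ℝ) =
        a * (a ^ (m + 1) / ((m + 1).factorial : ℝ)) := by ring
    have h3 : 0 ≤ a ^ (m + 1) / ((m + 1).factorial : ℝ) := by positivity
    have h4 : 0 ≤ ∑ j ∈ range (m + 1), a ^ j / (j.factorial : ℝ) :=
      sum_nonneg fun j _ => by positivity
    rw [h2]
    push_cast
    nlinarith

/-! ### Scaling of complex Gaussians -/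

instance isProbabilityMeasure_complexGaussian (v : ℝ≥0) :
    IsProbabilityMeasure (complexGaussian v) :=
  Measure.isProbabilityMeasure_map
    (Complex.measurableEquivRealProd.symm.measurable.aemeasurable)

theorem complexGaussian_map_const_mul (s : ℝ) :
    (complexGaussian 1).map (fun z => (s : ℂ) * z) = complexGaussian (s ^ 2).toNNReal := by
  have hmk : Measurable fun p : ℝ × ℝ => (⟨p.1, p.2⟩ : ℂ) :=
    Complex.measurableEquivRealProd.symm.measurable
  have hg : (gaussianReal 0 (1 / 2)).map (s * ·) = gaussianReal 0 ((s ^ 2).toNNReal / 2) := by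
    rw [gaussianReal_map_const_mul, mul_zero]
    congr 1
    ext
    simp [Real.coe_toNNReal _ (sq_nonneg s), div_eq_mul_inv]
  rw [complexGaussian, complexGaussian, ← hg,
    Measure.map_prod_map _ _ (by fun_prop) (by fun_prop), Measure.map_map (by fun_prop) hmk,
    Measure.map_map hmk (by fun_prop)]
  congr 1
  funext p
  apply Complex.ext <;> simp

theorem complexGaussianVector_eq_map_smul (m : ℕ) (s : ℝ) :
    complexGaussianVector m (s ^ 2).toNNReal =
      (complexGaussianVector m 1).map (fun z => (s : ℂ) • z) := by
  have hto : Measurable (WithLp.toLp 2 : (Fin m → ℂ) → EuclideanSpace ℂ (Fin m)) :=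
    (MeasurableEquiv.toLp 2 _).measurable
  have hsm : Measurable fun z : EuclideanSpace ℂ (Fin m) => (s : ℂ) • z :=
    (continuous_const_smul _).measurable
  have hp := Measure.pi_map_pi (μ := fun _ : Fin m => complexGaussian 1)
    (f := fun _ z => (s : ℂ) * z)
    (hμ := fun _ => by rw [complexGaussian_map_const_mul]; infer_instance)
    (fun _ => by fun_prop)
  simp only [complexGaussian_map_const_mul] at hp
  rw [complexGaussianVector, complexGaussianVector, ← hp, Measure.map_map hto (by fun_prop),
    Measure.map_map hsm hto]
  rfl

/-! ### Erlang tail of the squared norm -/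

/-- Polar coordinates for the squared modulus of a standard complex Gaussian. -/
theorem lintegral_complexGaussian_one_normSq (f : ℝ → ENNReal) (hf : Measurable f) :
    ∫⁻ z, f (‖z‖ ^ 2) ∂(complexGaussian 1) =
      ∫⁻ r in Set.Ioi (0 : ℝ), ENNReal.ofReal (2 * r * Real.exp (-r ^ 2)) * f (r ^ 2) := by
  have hmk : Measurable fun p : ℝ × ℝ => (⟨p.1, p.2⟩ : ℂ) :=
    Complex.measurableEquivRealProd.symm.measurable
  have hpdf : Measurable (gaussianPDF 0 (1 / 2)) := measurable_gaussianPDF _ _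
  rw [complexGaussian, lintegral_map (by fun_prop) hmk,
    gaussianReal_of_var_ne_zero _ (by norm_num), prod_withDensity hpdf hpdf,
    lintegral_withDensity_eq_lintegral_mul _ (by fun_prop) (by fun_prop), ← Measure.volume_eq_prod,
    ← lintegral_comp_polarCoord_symm]
  -- The angular factor `1/(2π)` is kept apart, so that the angle integrates to `1`.
  have hpt : ∀ p : ℝ × ℝ, p ∈ polarCoord.target →
      ENNReal.ofReal p.1 • ((fun z : ℝ × ℝ => gaussianPDF 0 (1 / 2) z.1 * gaussianPDF 0 (1 / 2) z.2) *
        fun p : ℝ × ℝ => f (‖(⟨p.1, p.2⟩ : ℂ)‖ ^ 2)) (polarCoord.symm p) =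
      (ENNReal.ofReal (2 * p.1 * Real.exp (-p.1 ^ 2)) * f (p.1 ^ 2)) *
        ENNReal.ofReal (1 / (2 * Real.pi)) := by
    rintro ⟨r, θ⟩ hp
    have hr : 0 < r := hp.1
    have hn : ‖(⟨r * Real.cos θ, r * Real.sin θ⟩ : ℂ)‖ ^ 2 = r ^ 2 := by
      rw [Complex.sq_norm, Complex.normSq_mk]
      linear_combination r ^ 2 * Real.sin_sq_add_cos_sq θ
    have hg : gaussianPDFReal 0 (1 / 2) (r * Real.cos θ) *
        gaussianPDFReal 0 (1 / 2) (r * Real.sin θ) = Real.exp (-r ^ 2) / Real.pi := by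
      have hpi : √Real.pi * √Real.pi = Real.pi := Real.mul_self_sqrt Real.pi_pos.le
      have he : Real.exp (-(r * Real.cos θ) ^ 2) * Real.exp (-(r * Real.sin θ) ^ 2) =
          Real.exp (-r ^ 2) := by
        rw [← Real.exp_add]
        congr 1
        linear_combination -r ^ 2 * Real.sin_sq_add_cos_sq θ
      have h2 : 2 * Real.pi * ((1 / 2 : ℝ≥0) : ℝ) = Real.pi := by push_cast; ring
      have h3 : 2 * ((1 / 2 : ℝ≥0) : ℝ) = 1 := by push_cast; ring
      simp only [gaussianPDFReal_def, h2, h3, sub_zero, div_one]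
      rw [mul_mul_mul_comm, he, ← mul_inv, hpi]
      ring
    simp only [polarCoord_symm_apply, Pi.mul_apply, smul_eq_mul, hn, gaussianPDF]
    rw [← ENNReal.ofReal_mul (gaussianPDFReal_nonneg _ _ _), hg, ← mul_assoc,
      ← ENNReal.ofReal_mul hr.le, mul_right_comm, ← ENNReal.ofReal_mul (by positivity)]
    congr 2
    field_simp
  rw [setLIntegral_congr_fun (by rw [polarCoord_target]; measurability) hpt, polarCoord_target,
    Measure.volume_eq_prod, ← Measure.prod_restrict,
    lintegral_prod_mul (f := fun r : ℝ => ENNReal.ofReal (2 * r * Real.exp (-r ^ 2)) * f (r ^ 2))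
      (g := fun _ : ℝ => ENNReal.ofReal (1 / (2 * Real.pi))) (by fun_prop) (by fun_prop)]
  have h1 : ∫⁻ _ in Set.Ioo (-Real.pi) Real.pi, ENNReal.ofReal (1 / (2 * Real.pi)) = 1 := by
    rw [setLIntegral_const, Real.volume_Ioo, ← ENNReal.ofReal_mul (by positivity)]
    have := Real.pi_pos.ne'
    rw [show 1 / (2 * Real.pi) * (Real.pi - -Real.pi) = 1 by field_simp; ring, ENNReal.ofReal_one]
  rw [h1, mul_one]

theorem lintegral_Ici_mul_exp_neg_sq {s : ℝ} (hs : 0 ≤ s) :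
    ∫⁻ r in Set.Ici s, ENNReal.ofReal (2 * r * Real.exp (-r ^ 2)) =
      ENNReal.ofReal (Real.exp (-s ^ 2)) := by
  have hd : ∀ r ∈ Set.Ici s, HasDerivAt (fun r : ℝ => -Real.exp (-r ^ 2))
      (2 * r * Real.exp (-r ^ 2)) r := fun r _ => by
    refine ((hasDerivAt_pow 2 r).fun_neg.exp.fun_neg).congr_deriv ?_
    simp
    ring
  have hnn : ∀ r ∈ Set.Ioi s, 0 ≤ 2 * r * Real.exp (-r ^ 2) := fun r hr => by
    have : 0 < r := hs.trans_lt hr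
    positivity
  have hlim : Filter.Tendsto (fun r : ℝ => -Real.exp (-r ^ 2)) Filter.atTop (nhds 0) := by
    have h := Real.tendsto_exp_neg_atTop_nhds_zero.comp
      (Filter.tendsto_pow_atTop (α := ℝ) two_ne_zero)
    simpa using h.neg
  rw [setLIntegral_congr Ioi_ae_eq_Ici.symm, ← ofReal_integral_eq_lintegral_ofReal
    (integrableOn_Ioi_deriv_of_nonneg' hd hnn hlim)
    ((ae_restrict_iff' measurableSet_Ioi).2 (Filter.Eventually.of_forall hnn)),
    integral_Ioi_of_hasDerivAt_of_nonneg' hd hnn hlim]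
  simp

/-- Raising each power of `a - r²` by one gives a primitive that vanishes at `r = √a`. This yields
all terms of the next Erlang sum except `j = 0`. -/
theorem lintegral_Ioo_mul_exp_mul_sum (m : ℕ) {a : ℝ} (ha : 0 < a) :
    ∫⁻ r in Set.Ioo 0 √a, ENNReal.ofReal (2 * r * (Real.exp (-a) *
        ∑ j ∈ Finset.range m, (a - r ^ 2) ^ j / (j.factorial : ℝ))) =
      ENNReal.ofReal (Real.exp (-a) *
        ∑ j ∈ Finset.range m, a ^ (j + 1) / ((j + 1).factorial : ℝ)) := by
  have hd : ∀ r : ℝ, HasDerivAt (fun r : ℝ => -(Real.exp (-a) *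
      ∑ j ∈ Finset.range m, (a - r ^ 2) ^ (j + 1) / ((j + 1).factorial : ℝ)))
      (2 * r * (Real.exp (-a) *
        ∑ j ∈ Finset.range m, (a - r ^ 2) ^ j / (j.factorial : ℝ))) r := by
    intro r
    have h : ∀ j ∈ Finset.range m,
        HasDerivAt (fun r : ℝ => (a - r ^ 2) ^ (j + 1) / ((j + 1).factorial : ℝ))
          (-(2 * r) * ((a - r ^ 2) ^ j / (j.factorial : ℝ))) r := fun j _ => by
      refine ((((hasDerivAt_pow 2 r).const_sub a).pow (j + 1)).div_const _).congr_deriv ?_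
      rw [Nat.factorial_succ]
      push_cast
      have : (j.factorial : ℝ) ≠ 0 := by positivity
      simp
      field_simp
    refine (((HasDerivAt.fun_sum h).const_mul _).neg).congr_deriv ?_
    rw [← Finset.mul_sum]
    ring
  have hcont : Continuous fun r : ℝ => 2 * r * (Real.exp (-a) *
      ∑ j ∈ Finset.range m, (a - r ^ 2) ^ j / (j.factorial : ℝ)) := by fun_prop
  rw [setLIntegral_congr Ioo_ae_eq_Ioc, ← ofReal_integral_eq_lintegral_ofReal
    (hcont.integrableOn_Ioc), ← intervalIntegral.integral_of_le (Real.sqrt_nonneg a),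
    intervalIntegral.integral_eq_sub_of_hasDerivAt (fun r _ => hd r)
      (hcont.intervalIntegrable _ _)]
  · simp [Real.sq_sqrt ha.le]
  · refine (ae_restrict_iff' measurableSet_Ioc).2 (Filter.Eventually.of_forall fun r hr => ?_)
    have : 0 ≤ a - r ^ 2 := sub_nonneg.2 ((Real.le_sqrt' hr.1).1 hr.2)
    have := hr.1
    simp only [Pi.zero_apply]
    positivity

/-- The Erlang bound on the tail of the squared norm of a standard complex Gaussian vector. -/
theorem pi_complexGaussian_one_tail_le (m : ℕ) : ∀ {a : ℝ}, 0 < a →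
    (Measure.pi fun _ : Fin m => complexGaussian 1) {z | a ≤ ∑ i, ‖z i‖ ^ 2} ≤
      ENNReal.ofReal (Real.exp (-a) * ∑ j ∈ Finset.range m, a ^ j / (j.factorial : ℝ)) := by
  induction m with
  | zero =>
    intro a ha
    simp [ha.not_ge]
  | succ m ih =>
    intro a ha
    set G : ℝ → ENNReal := fun b =>
      (Measure.pi fun _ : Fin m => complexGaussian 1) {z | b ≤ ∑ i, ‖z i‖ ^ 2} with hG
    have hGm : Measurable fun u => G (a - u) :=
      Monotone.measurable fun u v huv => measure_mono fun z hz =>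
        (sub_le_sub_left huv a).trans hz
    let s : Set (ℂ × (Fin m → ℂ)) := {p | a ≤ ‖p.1‖ ^ 2 + ∑ i, ‖p.2 i‖ ^ 2}
    have hs : MeasurableSet s := measurableSet_le measurable_const (by fun_prop)
    have hmp := measurePreserving_piFinSuccAbove (fun _ : Fin (m + 1) => complexGaussian 1) 0
    have hset : {z : Fin (m + 1) → ℂ | a ≤ ∑ i, ‖z i‖ ^ 2} =
        MeasurableEquiv.piFinSuccAbove (fun _ => ℂ) 0 ⁻¹' s := by
      ext z
      simp [s, Fin.sum_univ_succ, MeasurableEquiv.piFinSuccAbove, Fin.insertNthEquiv, Fin.tail]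
    have hsec : ∀ z : ℂ, (Measure.pi fun _ : Fin m => complexGaussian 1) (Prod.mk z ⁻¹' s) =
        G (a - ‖z‖ ^ 2) := fun z => by
      simp only [hG]
      congr 1
      ext w
      simp [s, add_comm]
    rw [hset, hmp.measure_preimage hs.nullMeasurableSet, Measure.prod_apply hs,
      lintegral_congr hsec, lintegral_complexGaussian_one_normSq _ hGm,
      -- Here `r` is the modulus of the first coordinate. Below `√a` the induction hypothesis bounds
      -- the other coordinates; beyond it their probability is at most `1`, which supplies the `j =
      -- 0` term `e^{-a}`.
      ← Set.Ioo_union_Ici_eq_Ioi (Real.sqrt_pos.2 ha)]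
    refine (lintegral_union_le _ _ _).trans ?_
    have h1 : ∫⁻ r in Set.Ioo 0 √a, ENNReal.ofReal (2 * r * Real.exp (-r ^ 2)) * G (a - r ^ 2) ≤
        ENNReal.ofReal (Real.exp (-a) *
          ∑ j ∈ Finset.range m, a ^ (j + 1) / ((j + 1).factorial : ℝ)) := by
      rw [← lintegral_Ioo_mul_exp_mul_sum m ha]
      refine setLIntegral_mono' measurableSet_Ioo fun r hr => ?_
      have hpos : 0 < a - r ^ 2 := sub_pos.2 ((Real.lt_sqrt hr.1.le).1 hr.2)
      refine (mul_le_mul_right (ih hpos) _).trans ?_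
      have := hr.1
      rw [← ENNReal.ofReal_mul (by positivity), mul_assoc, ← mul_assoc (Real.exp _),
        ← Real.exp_add, show -r ^ 2 + -(a - r ^ 2) = -a by ring]
    have h2 : ∫⁻ r in Set.Ici √a, ENNReal.ofReal (2 * r * Real.exp (-r ^ 2)) * G (a - r ^ 2) ≤
        ENNReal.ofReal (Real.exp (-a)) := by
      have := lintegral_Ici_mul_exp_neg_sq (Real.sqrt_nonneg a)
      rw [Real.sq_sqrt ha.le] at this
      rw [← this]
      exact lintegral_mono fun r => mul_le_of_le_one_right' prob_le_one
    refine (add_le_add h1 h2).trans_eq ?_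
    rw [← ENNReal.ofReal_add (by positivity) (by positivity), Finset.sum_range_succ']
    congr 1
    simp
    ring

/-! ### Stirling estimate and noise norm -/

theorem exp_neg_mul_sum_le {m : ℕ} (hm : m ≠ 0) :
    Real.exp (-(m + √(2 * m * Real.log (2 * m)))) *
      ∑ j ∈ Finset.range m, (m + √(2 * m * Real.log (2 * m))) ^ j / (j.factorial : ℝ) ≤
      1 / (2 * √(Real.pi * Real.log (2 * m))) := by
  have hm1 : (1 : ℝ) ≤ m := by exact_mod_cast Nat.one_le_iff_ne_zero.2 hm
  have hL : 0 < Real.log (2 * m) := Real.log_pos (by linarith)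
  set L := Real.log (2 * m)
  set t := √(2 * m * L) with ht
  have htpos : 0 < t := Real.sqrt_pos.2 (by positivity)
  set T := ∑ j ∈ Finset.range m, (m + t) ^ j / (j.factorial : ℝ)
  have hT : t * T ≤ m * (m + t) ^ m / (m.factorial : ℝ) := by
    obtain ⟨l, rfl⟩ := Nat.exists_eq_succ_of_ne_zero hm
    have h := sub_mul_sum_pow_div_factorial_le l (a := (l.succ : ℝ) + t) (by positivity)
    have h1 : (l.succ : ℝ) + t - (l + 1) = t := by push_cast; ring
    rw [h1] at h
    refine h.trans_eq ?_
    rw [Nat.factorial_succ]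
    push_cast
    field_simp
  -- This is `(1 + t/m)^m ≤ e^t`.
  have hpow : (m + t) ^ m ≤ (m : ℝ) ^ m * Real.exp t := by
    have h1 : m + t ≤ m * Real.exp (t / m) := by
      have := Real.add_one_le_exp (t / m)
      calc m + t = m * (t / m + 1) := by field_simp; ring
        _ ≤ _ := by gcongr
    calc (m + t) ^ m ≤ (m * Real.exp (t / m)) ^ m := by gcongr
      _ = _ := by
        rw [mul_pow, ← Real.exp_nat_mul]
        congr 2
        field_simp
  have hst := Stirling.le_factorial_stirling m
  -- With this `t`, the square root in Stirling's bound turns `m / (t √(2πm))` into exactly the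
  -- target constant.
  have hroot : t * √(2 * Real.pi * m) = m * (2 * √(Real.pi * L)) := by
    rw [ht, ← Real.sqrt_mul (by positivity), show 2 * m * L * (2 * Real.pi * m) =
      (2 * m) ^ 2 * (Real.pi * L) by ring, Real.sqrt_mul (by positivity),
      Real.sqrt_sq (by positivity)]
    ring
  have hfac : (0 : ℝ) < m.factorial := by positivity
  have hD : 0 < 2 * √(Real.pi * L) := by positivity
  rw [le_div_iff₀ hD]
  have hexp : (m : ℝ) ^ m * Real.exp t = Real.exp (m + t) * (m / Real.exp 1) ^ m := by
    rw [Real.exp_add, div_pow, ← Real.exp_nat_mul, mul_one]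
    field_simp
  have h3 : t * T * (m.factorial : ℝ) ≤ m * (Real.exp (m + t) * (m / Real.exp 1) ^ m) := by
    rw [← hexp]
    exact ((le_div_iff₀ hfac).1 hT).trans (by gcongr)
  have hTnn : 0 ≤ T := Finset.sum_nonneg fun j _ => by positivity
  have hq : 0 < (m / Real.exp 1) ^ m := by positivity
  have h4 : t * T * (√(2 * Real.pi * m) * (m / Real.exp 1) ^ m) ≤
      m * (Real.exp (m + t) * (m / Real.exp 1) ^ m) :=
    (mul_le_mul_of_nonneg_left hst (by positivity)).trans h3
  have h5 : m * (T * (2 * √(Real.pi * L))) * (m / Real.exp 1) ^ m ≤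
      m * Real.exp (m + t) * (m / Real.exp 1) ^ m := by
    calc _ = t * T * (√(2 * Real.pi * m) * (m / Real.exp 1) ^ m) := by
          linear_combination -(T * (m / Real.exp 1) ^ m) * hroot
      _ ≤ _ := h4
      _ = _ := by ring
  have h6 := le_of_mul_le_mul_left (le_of_mul_le_mul_right h5 hq) (by linarith)
  rw [Real.exp_neg, mul_assoc, inv_mul_le_iff₀ (Real.exp_pos _), mul_one]
  exact h6

theorem complexGaussianVector_one_tail_le {m : ℕ} (hm : m ≠ 0) :
    complexGaussianVector m 1
        {z | √((m : ℝ) + √(2 * (m : ℝ) * Real.log (2 * (m : ℝ)))) ≤ ‖z‖} ≤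
      ENNReal.ofReal (1 / (2 * √(Real.pi * Real.log (2 * (m : ℝ))))) := by
  have hto : Measurable (WithLp.toLp 2 : (Fin m → ℂ) → EuclideanSpace ℂ (Fin m)) :=
    (MeasurableEquiv.toLp 2 _).measurable
  rw [complexGaussianVector, Measure.map_apply hto (measurableSet_le measurable_const (by fun_prop))]
  have hset : (WithLp.toLp 2 : (Fin m → ℂ) → EuclideanSpace ℂ (Fin m)) ⁻¹'
      {z | √((m : ℝ) + √(2 * (m : ℝ) * Real.log (2 * (m : ℝ)))) ≤ ‖z‖} =
      {z | (m : ℝ) + √(2 * (m : ℝ) * Real.log (2 * (m : ℝ))) ≤ ∑ i, ‖z i‖ ^ 2} := by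
    ext z
    simp only [Set.mem_preimage, Set.mem_ofPred_eq, EuclideanSpace.norm_eq]
    exact Real.sqrt_le_sqrt_iff (Finset.sum_nonneg fun i _ => sq_nonneg _)
  rw [hset]
  exact (pi_complexGaussian_one_tail_le m (by positivity)).trans
    (ENNReal.ofReal_le_ofReal (exp_neg_mul_sum_le hm))

instance isProbabilityMeasure_complexGaussianVector (m : ℕ) (v : ℝ≥0) :
    IsProbabilityMeasure (complexGaussianVector m v) :=
  Measure.isProbabilityMeasure_map (MeasurableEquiv.toLp 2 _).measurable.aemeasurable

/-- A complex Gaussian vector is zero or strictly shorter than `σ √(m + √(2 m log (2 m)))` with the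
stated probability; the first alternative matters only for `σ = 0`. -/
theorem le_complexGaussianVector_norm_lt {m : ℕ} (hm : m ≠ 0) {σ : ℝ} (hσ : 0 ≤ σ) :
    1 - 1 / (2 * √(Real.pi * Real.log (2 * (m : ℝ)))) ≤
      (complexGaussianVector m (σ ^ 2).toNNReal).real
        {z | ‖z‖ < σ * √((m : ℝ) + √(2 * (m : ℝ) * Real.log (2 * (m : ℝ)))) ∨ z = 0} := by
  set b := √((m : ℝ) + √(2 * (m : ℝ) * Real.log (2 * (m : ℝ))))
  have hB : MeasurableSet {z : EuclideanSpace ℂ (Fin m) | ‖z‖ < σ * b ∨ z = 0} :=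
    (measurableSet_lt measurable_norm measurable_const).union (measurableSet_singleton 0)
  have hA : MeasurableSet {z : EuclideanSpace ℂ (Fin m) | b ≤ ‖z‖} :=
    measurableSet_le measurable_const (by fun_prop)
  have hsm : Measurable fun z : EuclideanSpace ℂ (Fin m) => (σ : ℂ) • z :=
    (continuous_const_smul _).measurable
  have htail : (complexGaussianVector m 1).real {z | b ≤ ‖z‖} ≤
      1 / (2 * √(Real.pi * Real.log (2 * (m : ℝ)))) :=
    ENNReal.toReal_le_of_le_ofReal (by positivity) (complexGaussianVector_one_tail_le hm)
  rw [complexGaussianVector_eq_map_smul, map_measureReal_apply hsm hB]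
  refine (sub_le_sub_left htail 1).trans ?_
  rw [← probReal_compl_eq_one_sub hA]
  refine measureReal_mono fun z hz => ?_
  have hz' : ‖z‖ < b := not_le.1 hz
  rcases hσ.eq_or_lt with rfl | hσ
  · exact Or.inr (by simp)
  · refine Or.inl ?_
    rw [norm_smul, Complex.norm_real, Real.norm_of_nonneg hσ.le]
    exact mul_lt_mul_of_pos_left hz' hσ

/-! ### Exact recovery under Gaussian noise -/

theorem theorem3 {m n k : ℕ} {Ω : Type*} [MeasurableSpace Ω] (P : Measure Ω)
    [IsProbabilityMeasure P]
    (Ψ : Matrix (Fin m) (Fin n) ℂ) (hΨ : ∀ j, ‖atom Ψ j‖ = 1)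
    (x : Fin n → ℂ) (hx : x ≠ 0) (hk : (vecSupport x).card ≤ k)
    (σ : ℝ) (hσ : 0 ≤ σ)
    (noise : Ω → EuclideanSpace ℂ (Fin m))
    (hnoise : HasLaw noise (complexGaussianVector m (σ ^ 2).toNNReal) P)
    (hμ : mutualCoherence Ψ < 1 / (2 * (k : ℝ) - 1))
    (hmin : ∀ i, x i ≠ 0 →
      2 * σ * √((m : ℝ) + √(2 * (m : ℝ) * Real.log (2 * (m : ℝ)))) /
        (1 - (2 * (k : ℝ) - 1) * mutualCoherence Ψ) ≤ ‖x i‖) :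
    ∃ E : Set Ω, MeasurableSet E ∧
      1 - 1 / (2 * √(Real.pi * Real.log (2 * (m : ℝ)))) ≤ P.real E ∧
      ∀ ω ∈ E, OMPSelects Ψ (WithLp.toLp 2 (Ψ.mulVec x) + noise ω)
        (σ * √((m : ℝ) + √(2 * (m : ℝ) * Real.log (2 * (m : ℝ))))) (vecSupport x) := by
  obtain ⟨i₀, hi₀⟩ := Function.ne_iff.1 hx
  have hm : m ≠ 0 := by
    rintro rfl
    have := hΨ i₀
    rw [Subsingleton.elim (atom Ψ i₀) 0, norm_zero] at this
    exact zero_ne_one this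
  have hk1 : (1 : ℝ) ≤ k := by
    exact_mod_cast (Finset.card_pos.2 ⟨i₀, by simpa [vecSupport] using hi₀⟩).trans_le hk
  have hD : 0 < 1 - (2 * (k : ℝ) - 1) * mutualCoherence Ψ := by
    rw [lt_div_iff₀ (by linarith)] at hμ
    linarith
  have hprob := le_complexGaussianVector_norm_lt hm hσ
  set b := σ * √((m : ℝ) + √(2 * (m : ℝ) * Real.log (2 * (m : ℝ)))) with hb
  have hb0 : 0 ≤ b := by positivity
  have hB : MeasurableSet {z : EuclideanSpace ℂ (Fin m) | ‖z‖ < b ∨ z = 0} :=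
    (measurableSet_lt measurable_norm measurable_const).union (measurableSet_singleton 0)
  -- The noise is only almost everywhere measurable, so its good event is replaced by a measurable
  -- subset of equal probability.
  obtain ⟨E, hEsub, hE, hEae⟩ :=
    (hnoise.aemeasurable.nullMeasurableSet_preimage hB).exists_measurable_subset_ae_eq
  refine ⟨E, hE, ?_, fun ω hω => ?_⟩
  · rw [measureReal_congr hEae, ← map_measureReal_apply_of_aemeasurable hnoise.aemeasurable hB,
      hnoise.map_eq]
    exact hprob
  · have hω' : ‖noise ω‖ < b ∨ noise ω = 0 := hEsub hω
    refine ompSelects_of_norm_le Ψ hΨ x hx hk (noise ω) ?_ (fun i hi => ?_) hD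
    · rcases hω' with h | h
      · exact h.le
      · rwa [h, norm_zero]
    · have h1 := hmin i hi
      rw [div_le_iff₀ hD, mul_assoc, ← hb] at h1
      have h2 := mul_pos hD (norm_pos_iff.2 hi)
      -- The coefficient bound only gives `2b ≤ (1 - (2k-1)μ)|x_i|`. Strictness comes from `‖e‖ <
      -- b`, or, for zero noise, from positivity of the right side.
      rcases hω' with h | h
      · linarith
      · rw [h, norm_zero]
        linarith
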